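/- Let $k\ge 1$, let $n_1,\dots,n_k\ge 1$ be integers and let $\mathcal H$ be a complex Hilbert space. Let $F^2(H_{n_i})$ be the full Fock space of an $n_i$-dimensional complex Hilbert space $H_{n_i}$, with orthonormal basis $\{e^i_\alpha\}$ indexed by the words $\alpha$ in the unital free semigroup $\mathbb F_{n_i}^+$ on the generators $g^i_1,\dots,g^i_{n_i}$. Let $S_{i,j}e^i_\alpha=e^i_{g^i_j\alpha}$ be the left creation operators, and let ${\bf W}_{i,j}=I\otimes\cdots\otimes I\otimes S_{i,j}\otimes I\otimes\cdots\otimes I$ (with $S_{i,j}$ in the $i$-th position), acting on $\otimes_{i=1}^kF^2(H_{n_i})$; the tuple ${\bf W}=({\bf W}_{i,j})$, $1\le i\le k$, $1\le j\le n_i$, is the universal model of the noncommutative polyball. A bounded operator $\Phi:(\otimes_iF^2(H_{n_i}))\otimes\mathcal L\to(\otimes_iF^2(H_{n_i}))\otimes\mathcal H$ is called multi-analytic if $\Phi({\bf W}_{i,j}\otimes I_{\mathcal L})=({\bf W}_{i,j}\otimes I_{\mathcal H})\Phi$ for all $i,j$. A tuple $T=(T_{i,j})$ of bounded operators on a Hilbert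 space is called doubly commuting if, for all $i_1\ne i_2$ and all $j_1,j_2$, the operator $T_{i_1,j_1}$ commutes with both $T_{i_2,j_2}$ and $T_{i_2,j_2}^*$. (a) Let $\mathcal M\subset(\otimes_{i=1}^kF^2(H_{n_i}))\otimes\mathcal H$ be a nonzero closed subspace invariant under all the operators ${\bf W}_{i,j}\otimes I_{\mathcal H}$. Then the tuple of restrictions $({\bf W}_{i,j}\otimes I_{\mathcal H})|_{\mathcal M}$ is doubly commuting (adjoints being taken in $B(\mathcal M)$) if and only if there are a Hilbert space $\mathcal L$ and an isometric multi-analytic operator $\Phi:(\otimes_{i=1}^kF^2(H_{n_i}))\otimes\mathcal L\to(\otimes_{i=1}^kF^2(H_{n_i}))\otimes\mathcal H$ such that $\mathcal M=\Phi\big((\otimes_{i=1}^kF^2(H_{n_i}))\otimes\mathcal L\big)$. (b) (The case $n_1=\cdots=n_k=1$, on the polydisc.) Let $H^2(\mathbb D^k)$ be the Hardy space of the functions $f(z)=\sum_{\alpha\in\mathbb Z_+^k}c_\alpha z^\alpha$ on $\mathbb D^k$ with $\|f\|^2=\sum_\alpha|c_\alpha|^2<\infty$, and let $M_{z_i}$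 be multiplication by $z_i$ on it. Let $\mathcal M\subset H^2(\mathbb D^k)\otimes\mathcal H$ be a nonzero closed subspace invariant under $M_{z_1}\otimes I_{\mathcal H},\dots,M_{z_k}\otimes I_{\mathcal H}$. Then the tuple of restrictions $(M_{z_i}\otimes I_{\mathcal H})|_{\mathcal M}$, $1\le i\le k$, is doubly commuting if and only if there are a Hilbert space $\mathcal L$ and an isometry $\Phi:H^2(\mathbb D^k)\otimes\mathcal L\to H^2(\mathbb D^k)\otimes\mathcal H$ with $\Phi(M_{z_i}\otimes I_{\mathcal L})=(M_{z_i}\otimes I_{\mathcal H})\Phi$ for all $i$ and $\mathcal M=\Phi\big(H^2(\mathbb D^k)\otimes\mathcal L\big)$. -/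

import Mathlib

universe u

noncomputable section

open scoped TensorProduct

namespace Polyball

/-! ### Hilbert tensor products and ampliations -/

/-- The Hilbert space tensor product `E ⊗ H`: the completion of the algebraic tensor product
for the inner product `⟪a ⊗ h, b ⊗ g⟫ = ⟪a, b⟫ ⟪h, g⟫`. -/
abbrev HTensor (E : Type*) [NormedAddCommGroup E] [InnerProductSpace ℂ E]
    (H : Type*) [NormedAddCommGroup H] [InnerProductSpace ℂ H] : Type _ :=
  UniformSpace.Completion (E ⊗[ℂ] H)

/-- The operator `T ⊗ I_H` on the Hilbert tensor product `E ⊗ H`. -/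
def ampl {E : Type*} [NormedAddCommGroup E] [InnerProductSpace ℂ E] (T : E →L[ℂ] E)
    (H : Type*) [NormedAddCommGroup H] [InnerProductSpace ℂ H] :
    HTensor E H →L[ℂ] HTensor E H :=
  (ContinuousLinearMap.rTensor H T).completion

theorem ampl_tmul {E : Type*} [NormedAddCommGroup E] [InnerProductSpace ℂ E] (T : E →L[ℂ] E)
    {H : Type*} [NormedAddCommGroup H] [InnerProductSpace ℂ H] (x : E) (h : H) :
    ampl T H ((x ⊗ₜ[ℂ] h : E ⊗[ℂ] H) : HTensor E H) =
      ((T x ⊗ₜ[ℂ] h : E ⊗[ℂ] H) : HTensor E H) := by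
  rw [ampl, ContinuousLinearMap.completion_apply_coe]
  rfl

/-! ### Tuples of operators -/

section Tuples

variable {k : ℕ} {n : Fin k → ℕ}
variable {K : Type*} [NormedAddCommGroup K] [InnerProductSpace ℂ K]

/-- `M` is (jointly) invariant under the operators `T i j`. -/
def IsJointlyInvariant (T : ∀ i, Fin (n i) → K →L[ℂ] K) (M : Submodule ℂ K) : Prop :=
  ∀ i j, ∀ x ∈ M, T i j x ∈ M

/-- The restriction `T|_M` of a tuple of operators to an invariant subspace. -/
def restrictTuple (T : ∀ i, Fin (n i) → K →L[ℂ] K) (M : Submodule ℂ K) (hM : IsJointlyInvariant T M) :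
    ∀ i, Fin (n i) → M →L[ℂ] M :=
  fun i j => (T i j).restrict (hM i j)

/-- A `k`-tuple `T = (T_1, …, T_k)` of tuples of operators on a Hilbert space is doubly commuting
if for `i₁ ≠ i₂` every entry of `T_{i₁}` commutes with every entry of `T_{i₂}` and with the
adjoint of every entry of `T_{i₂}`. There is no condition on entries of the same `T_i`. -/
def DoublyCommuting (n : Fin k → ℕ) (K : Type*) [NormedAddCommGroup K] [InnerProductSpace ℂ K]
    [CompleteSpace K] (T : ∀ i, Fin (n i) → K →L[ℂ] K) : Prop :=
  ∀ i₁ i₂, i₁ ≠ i₂ → ∀ (j₁ : Fin (n i₁)) (j₂ : Fin (n i₂)),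
    T i₁ j₁ ∘L T i₂ j₂ = T i₂ j₂ ∘L T i₁ j₁ ∧
    T i₁ j₁ ∘L ContinuousLinearMap.adjoint (T i₂ j₂) =
      ContinuousLinearMap.adjoint (T i₂ j₂) ∘L T i₁ j₁

variable {E : Type*} [NormedAddCommGroup E] [InnerProductSpace ℂ E]

/-- The tuple `W ⊗ I_H = (W_{i,j} ⊗ I_H)`. -/
def amplTuple (W : ∀ i, Fin (n i) → E →L[ℂ] E)
    (H : Type*) [NormedAddCommGroup H] [InnerProductSpace ℂ H] :
    ∀ i, Fin (n i) → HTensor E H →L[ℂ] HTensor E H :=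
  fun i j => ampl (W i j) H

/-- `Φ : E ⊗ L → E ⊗ H` is multi-analytic with respect to the tuple `W` on `E`:
`Φ (W_{i,j} ⊗ I_L) = (W_{i,j} ⊗ I_H) Φ`. -/
def IsMultiAnalytic (W : ∀ i, Fin (n i) → E →L[ℂ] E)
    {L : Type*} [NormedAddCommGroup L] [InnerProductSpace ℂ L]
    {H : Type*} [NormedAddCommGroup H] [InnerProductSpace ℂ H]
    (Φ : HTensor E L →L[ℂ] HTensor E H) : Prop :=
  ∀ i j, Φ ∘L amplTuple W L i j = amplTuple W H i j ∘L Φ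

end Tuples

instance completeSpace_closedSubmodule {K : Type*} [NormedAddCommGroup K] [InnerProductSpace ℂ K]
    [CompleteSpace K] (M : ClosedSubmodule ℂ K) : CompleteSpace M.toSubmodule :=
  M.isClosed.completeSpace_coe

/-! ### The full Fock spaces and the universal model of the polyball -/

section Fock

variable {k : ℕ}

/-- `k`-tuples `β = (β_1, …, β_k)` of words, `β_i` in the free monoid on `n_i` generators. -/
abbrev Words (n : Fin k → ℕ) : Type := ∀ i, FreeMonoid (Fin (n i))

instance decidableEqWords (n : Fin k → ℕ) : DecidableEq (Words n) := Classical.decEq _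

/-- The Hilbert space `F²(H_{n_1}) ⊗ ⋯ ⊗ F²(H_{n_k})`, where `F²(H_m)` is the full Fock space of
an `m`-dimensional Hilbert space. It is given as `ℓ²` over its orthonormal basis
`e_β = e^1_{β_1} ⊗ ⋯ ⊗ e^k_{β_k}`, indexed by the tuples of words. -/
abbrev PolyFock (n : Fin k → ℕ) : Type := lp (fun _ : Words n => ℂ) 2

/-- The basis vector `e^1_{β_1} ⊗ ⋯ ⊗ e^k_{β_k}`. -/
def basisVec {n : Fin k → ℕ} (β : Words n) : PolyFock n := lp.single 2 β (1 : ℂ)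

/-- `β ↦ (β_1, …, g_j β_i, …, β_k)`. -/
def prepend {n : Fin k → ℕ} (i : Fin k) (j : Fin (n i)) (β : Words n) : Words n :=
  Function.update β i (FreeMonoid.of j * β i)

theorem prepend_injective {n : Fin k → ℕ} (i : Fin k) (j : Fin (n i)) :
    Function.Injective (prepend (n := n) i j) := by
  intro β γ h
  funext l
  have hl := congrFun h l
  by_cases hli : l = i
  · subst hli
    simpa [prepend] using hl
  · simpa [prepend, hli] using hl

theorem orthonormal_basisVec_prepend {n : Fin k → ℕ} (i : Fin k) (j : Fin (n i)) :
    Orthonormal ℂ (fun β : Words n => basisVec (prepend i j β)) := by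
  rw [orthonormal_iff_ite]
  intro β γ
  simp only [basisVec, lp.inner_single_left, lp.single_apply, Pi.single_apply,
    (prepend_injective i j).eq_iff]
  split_ifs <;> simp

/-- The universal model of the polyball: `W_{i,j} = I ⊗ ⋯ ⊗ S_j ⊗ ⋯ ⊗ I`, with the left creation
operator `S_j : e_α ↦ e_{g_j α}` of the `i`-th full Fock space in position `i`. -/
def universalModel (n : Fin k → ℕ) (i : Fin k) (j : Fin (n i)) : PolyFock n →L[ℂ] PolyFock n :=
  ((orthonormal_basisVec_prepend i j).orthogonalFamily.linearIsometry).toContinuousLinearMap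

theorem universalModel_basisVec (n : Fin k → ℕ) (i : Fin k) (j : Fin (n i)) (β : Words n) :
    universalModel n i j (basisVec β) = basisVec (prepend i j β) := by
  have h := (orthonormal_basisVec_prepend i j).orthogonalFamily.linearIsometry_apply_single
    (i := β) (1 : ℂ)
  exact h.trans (by simp)

end Fock

/-! ### The Hardy space of the polydisc -/

/-- The open unit polydisc `𝔻^k`. -/
abbrev Polydisc (k : ℕ) : Type := {z : Fin k → ℂ // ∀ i, ‖z i‖ < 1}

/-- `z^α = ∏ i, z_i ^ α_i`. -/
def monomial {k : ℕ} (z : Fin k → ℂ) (α : Fin k → ℕ) : ℂ := ∏ i, z i ^ α i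

theorem summable_norm_monomial : ∀ {k : ℕ} (z : Fin k → ℂ), (∀ i, ‖z i‖ < 1) →
    Summable (fun α : Fin k → ℕ => ‖monomial z α‖)
  | 0, _, _ => Summable.of_finite
  | k + 1, z, hz => by
    have h1 : Summable (fun m : ℕ => ‖z 0‖ ^ m) :=
      summable_geometric_of_lt_one (norm_nonneg _) (hz 0)
    have h2 := summable_norm_monomial (fun i : Fin k => z i.succ) (fun i => hz i.succ)
    have h3 := h1.mul_of_nonneg h2 (fun _ => by positivity) (fun _ => by positivity)
    rw [← (Fin.consEquiv (fun _ : Fin (k + 1) => ℕ)).summable_iff]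
    refine h3.congr fun p => ?_
    simp [monomial, Fin.prod_univ_succ, Fin.consEquiv]

theorem coeff_eq_zero_of_hasSum_pow (g : ℕ → ℂ)
    (h : ∀ w : ℂ, ‖w‖ < 1 → HasSum (fun m => w ^ m * g m) 0) (m : ℕ) : g m = 0 := by
  let p : FormalMultilinearSeries ℂ ℂ ℂ :=
    fun m => ContinuousMultilinearMap.mkPiRing ℂ (Fin m) (g m)
  have hc : ∀ m, p.coeff m = g m := fun m => by simp [p, FormalMultilinearSeries.coeff]
  have hp : HasFPowerSeriesAt (0 : ℂ → ℂ) p 0 := by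
    rw [hasFPowerSeriesAt_iff]
    filter_upwards [Metric.ball_mem_nhds (0 : ℂ) one_pos] with w hw
    simp only [hc, smul_eq_mul, Pi.zero_apply]
    exact h w (by simpa using hw)
  rw [← hc m, hp.eq_zero]
  simp [FormalMultilinearSeries.coeff]

theorem coeff_eq_zero_of_hasSum_monomial : ∀ {k : ℕ} (c : (Fin k → ℕ) → ℂ),
    (∀ z : Fin k → ℂ, (∀ i, ‖z i‖ < 1) → HasSum (fun α => c α * monomial z α) 0) → ∀ α, c α = 0
  | 0, c, h, α => by
    have h0 := h (fun _ => 0) (fun i => i.elim0)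
    have h2 := h0.unique (hasSum_unique (fun α => c α * monomial (fun _ => 0) α))
    simp only [monomial, Finset.univ_eq_empty, Finset.prod_empty, mul_one] at h2
    rw [h2]
    exact congrArg c (Subsingleton.elim _ _)
  | k + 1, c, h, α => by
    have key : ∀ z' : Fin k → ℂ, (∀ i, ‖z' i‖ < 1) → ∀ m : ℕ,
        HasSum (fun β : Fin k → ℕ => c (Fin.cons m β) * monomial z' β) 0 := by
      intro z' hz'
      have hs : ∀ w : ℂ, ‖w‖ < 1 → HasSum (fun p : ℕ × (Fin k → ℕ) =>
          w ^ p.1 * (c (Fin.cons p.1 p.2) * monomial z' p.2)) 0 := by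
        intro w hw
        have h0 := h (Fin.cons (α := fun _ => ℂ) w z') (Fin.cases hw hz')
        rw [← (Fin.consEquiv (fun _ : Fin (k + 1) => ℕ)).hasSum_iff] at h0
        refine (congrArg (fun F => HasSum F (0 : ℂ)) (funext fun p => ?_)).mpr h0
        have hp : (Fin.consEquiv fun _ : Fin (k + 1) => ℕ) p = Fin.cons p.1 p.2 := rfl
        simp only [Function.comp_apply, hp, monomial, Fin.prod_univ_succ,
          Fin.cons_zero, Fin.cons_succ]
        ring
      have hfib : ∀ m : ℕ, Summable (fun β : Fin k → ℕ => c (Fin.cons m β) * monomial z' β) := by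
        intro m
        have hhalf : ‖(1 / 2 : ℂ)‖ < 1 := by norm_num
        have hne : ((1 / 2 : ℂ)) ^ m ≠ 0 := pow_ne_zero m (by norm_num)
        have h1 : Summable (fun β : Fin k → ℕ =>
            (1 / 2 : ℂ) ^ m * (c (Fin.cons m β) * monomial z' β)) :=
          (hs (1 / 2) hhalf).summable.prod_factor m
        exact (summable_mul_left_iff hne).1 h1
      let g : ℕ → ℂ := fun m => ∑' β : Fin k → ℕ, c (Fin.cons m β) * monomial z' β
      have hone : ∀ w : ℂ, ‖w‖ < 1 → HasSum (fun m => w ^ m * g m) 0 := fun w hw =>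
        (hs w hw).prod_fiberwise fun m => (hfib m).hasSum.mul_left (w ^ m)
      intro m
      have hgm : g m = 0 := coeff_eq_zero_of_hasSum_pow g hone m
      exact hgm ▸ (hfib m).hasSum
    have h1 := coeff_eq_zero_of_hasSum_monomial (fun β => c (Fin.cons (α 0) β))
      (fun z' hz' => key z' hz' (α 0)) (Fin.tail α)
    simpa [Fin.cons_self_tail] using h1

/-- The functions `f` on `𝔻^k` of the form `f(z) = ∑_α c_α z^α` with `∑_α |c_α|² < ∞`. -/
def hardySubmodule (k : ℕ) : Submodule ℂ (Polydisc k → ℂ) where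
  carrier := {f | ∃ c : lp (fun _ : Fin k → ℕ => ℂ) 2,
    ∀ z, HasSum (fun α => c α * monomial z.1 α) (f z)}
  zero_mem' := ⟨0, fun z => by simp⟩
  add_mem' := by
    rintro f g ⟨c, hc⟩ ⟨d, hd⟩
    exact ⟨c + d, fun z => by simpa [add_mul] using (hc z).add (hd z)⟩
  smul_mem' := by
    rintro a f ⟨c, hc⟩
    exact ⟨a • c, fun z => by simpa [mul_assoc] using (hc z).mul_left a⟩

/-- The Hardy space `H²(𝔻^k)`. -/
def HardySpace (k : ℕ) : Type := hardySubmodule k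

namespace HardySpace

variable {k : ℕ}

instance : AddCommGroup (HardySpace k) := inferInstanceAs (AddCommGroup (hardySubmodule k))
instance : Module ℂ (HardySpace k) := inferInstanceAs (Module ℂ (hardySubmodule k))
instance : CoeFun (HardySpace k) (fun _ => Polydisc k → ℂ) := ⟨fun f => f.1⟩

theorem hasSum_series (c : lp (fun _ : Fin k → ℕ => ℂ) 2) (z : Polydisc k) :
    HasSum (fun α => c α * monomial z.1 α) (∑' α, c α * monomial z.1 α) := by
  refine Summable.hasSum (Summable.of_norm_bounded
    (g := fun α => ‖c‖ * ‖monomial z.1 α‖) ((summable_norm_monomial z.1 z.2).mul_left _) ?_)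
  intro α
  rw [norm_mul]
  gcongr
  exact lp.norm_apply_le_norm two_ne_zero c α

theorem coeff_unique {f : Polydisc k → ℂ} {c d : lp (fun _ : Fin k → ℕ => ℂ) 2}
    (hc : ∀ z, HasSum (fun α => c α * monomial z.1 α) (f z))
    (hd : ∀ z, HasSum (fun α => d α * monomial z.1 α) (f z)) : c = d := by
  have h := coeff_eq_zero_of_hasSum_monomial (fun α => c α - d α) (fun z hz => by
    simpa [sub_mul] using (hc ⟨z, hz⟩).sub (hd ⟨z, hz⟩))
  ext α
  exact sub_eq_zero.1 (h α)

/-- `f ↦` its sequence of Taylor coefficients, a bijection of `H²(𝔻^k)` onto `ℓ²(ℕ^k)`. -/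
def coeffEquiv : HardySpace k ≃ₗ[ℂ] lp (fun _ : Fin k → ℕ => ℂ) 2 :=
  LinearEquiv.symm
    { toFun := fun c => ⟨fun z => ∑' α, c α * monomial z.1 α, c, fun z => hasSum_series c z⟩
      map_add' := fun c d => Subtype.ext <| funext fun z => by
        have h := (hasSum_series c z).add (hasSum_series d z)
        refine HasSum.tsum_eq ?_
        simp only [lp.coeFn_add, Pi.add_apply, add_mul]
        exact h
      map_smul' := fun a c => Subtype.ext <| funext fun z => by
        have h := (hasSum_series c z).mul_left a
        refine HasSum.tsum_eq ?_
        simp only [lp.coeFn_smul, Pi.smul_apply, smul_eq_mul, mul_assoc]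
        exact h
      invFun := fun f => f.2.choose
      left_inv := fun c => coeff_unique (fun z => Exists.choose_spec
        (⟨c, fun z => hasSum_series c z⟩ : ∃ d : lp (fun _ : Fin k → ℕ => ℂ) 2, ∀ z : Polydisc k,
          HasSum (fun α => d α * monomial z.1 α) (∑' α, c α * monomial z.1 α)) z)
        (hasSum_series c)
      right_inv := fun f => Subtype.ext <| funext fun z => (f.2.choose_spec z).tsum_eq }

theorem hasSum_coeff (f : HardySpace k) (z : Polydisc k) :
    HasSum (fun α => coeffEquiv f α * monomial z.1 α) (f z) :=
  f.2.choose_spec z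

/-- The norm `‖f‖ = (∑_α |c_α|²)^{1/2}` in terms of the Taylor coefficients. -/
instance : NormedAddCommGroup (HardySpace k) :=
  NormedAddCommGroup.induced (HardySpace k) (lp (fun _ : Fin k → ℕ => ℂ) 2)
    (coeffEquiv (k := k)) coeffEquiv.injective

instance : InnerProductSpace ℂ (HardySpace k) where
  toNormedSpace := NormedSpace.induced ℂ (HardySpace k) (lp (fun _ : Fin k → ℕ => ℂ) 2)
    (coeffEquiv (k := k))
  inner f g := inner ℂ (coeffEquiv f) (coeffEquiv g)
  norm_sq_eq_re_inner f := norm_sq_eq_re_inner (𝕜 := ℂ) (coeffEquiv f)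
  conj_inner_symm f g := inner_conj_symm (coeffEquiv f) (coeffEquiv g)
  add_left f g h := by rw [map_add]; exact inner_add_left _ _ _
  smul_left f g a := by rw [map_smul]; exact inner_smul_left _ _ _

theorem norm_coeffEquiv (f : HardySpace k) : ‖coeffEquiv f‖ = ‖f‖ := rfl

instance : CompleteSpace (HardySpace k) :=
  let e : HardySpace k ≃ₗᵢ[ℂ] lp (fun _ : Fin k → ℕ => ℂ) 2 := ⟨coeffEquiv, norm_coeffEquiv⟩
  (completeSpace_congr (e := e.toEquiv) e.isometry.isUniformEmbedding).2 inferInstance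

/-- The exponent `α + ε_i`. -/
def raise (i : Fin k) (α : Fin k → ℕ) : Fin k → ℕ := Function.update α i (α i + 1)

theorem raise_injective (i : Fin k) : Function.Injective (raise i) := by
  intro α β h
  funext l
  have hl := congrFun h l
  by_cases hli : l = i
  · subst hli
    simpa [raise] using hl
  · simpa [raise, hli] using hl

theorem monomial_raise (z : Fin k → ℂ) (i : Fin k) (α : Fin k → ℕ) :
    monomial z (raise i α) = z i * monomial z α := by
  have h : ∏ l ∈ Finset.univ.erase i, z l ^ raise i α l = ∏ l ∈ Finset.univ.erase i, z l ^ α l :=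
    Finset.prod_congr rfl fun l hl => by simp [raise, Finset.ne_of_mem_erase hl]
  have h1 := Finset.mul_prod_erase Finset.univ (fun l => z l ^ raise i α l) (Finset.mem_univ i)
  have h2 := Finset.mul_prod_erase Finset.univ (fun l => z l ^ α l) (Finset.mem_univ i)
  rw [monomial, monomial, ← h1, ← h2]
  rw [h]
  simp [raise, pow_succ]
  ring

/-- The Taylor coefficients of `z_i f` in terms of those of `f`. -/
def shiftCoeff (i : Fin k) (c : lp (fun _ : Fin k → ℕ => ℂ) 2) :
    lp (fun _ : Fin k → ℕ => ℂ) 2 :=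
  ⟨Function.extend (raise i) c 0, by
    refine memℓp_gen ?_
    have h := (lp.memℓp c).summable (by norm_num)
    refine ((raise_injective i).summable_iff ?_).1 (h.congr fun α => ?_)
    · intro α hα
      rw [Function.extend_apply' _ _ _ (by simpa using hα)]
      simp
    · simp [(raise_injective i).extend_apply]⟩

theorem shiftCoeff_raise (i : Fin k) (c : lp (fun _ : Fin k → ℕ => ℂ) 2) (α : Fin k → ℕ) :
    shiftCoeff i c (raise i α) = c α :=
  (raise_injective i).extend_apply _ _ _

theorem shiftCoeff_of_notMem (i : Fin k) (c : lp (fun _ : Fin k → ℕ => ℂ) 2) {α : Fin k → ℕ}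
    (hα : α ∉ Set.range (raise i)) : shiftCoeff i c α = 0 :=
  Function.extend_apply' _ _ _ hα

theorem norm_shiftCoeff (i : Fin k) (c : lp (fun _ : Fin k → ℕ => ℂ) 2) :
    ‖shiftCoeff i c‖ = ‖c‖ := by
  rw [lp.norm_eq_tsum_rpow (by norm_num), lp.norm_eq_tsum_rpow (by norm_num)]
  congr 1
  rw [← (raise_injective i).tsum_eq]
  · exact tsum_congr fun α => by simp only [shiftCoeff_raise]
  · intro α hα
    by_contra hr
    refine hα ?_
    simp [shiftCoeff_of_notMem i c hr]

theorem hasSum_shiftCoeff (i : Fin k) (f : HardySpace k) (z : Polydisc k) :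
    HasSum (fun α => shiftCoeff i (coeffEquiv f) α * monomial z.1 α) (z.1 i * f z) := by
  refine ((raise_injective i).hasSum_iff ?_).1 ?_
  · intro α hα
    rw [shiftCoeff_of_notMem i _ hα, zero_mul]
  · refine (congrArg (fun F => HasSum F (z.1 i * f z)) (funext fun α => ?_)).mpr
      ((hasSum_coeff f z).mul_left (z.1 i))
    simp only [Function.comp_apply, shiftCoeff_raise, monomial_raise]
    ring

/-- Multiplication by the coordinate function `z_i` on `H²(𝔻^k)`. -/
def mulCoord (i : Fin k) : HardySpace k →L[ℂ] HardySpace k :=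
  LinearMap.mkContinuous
    { toFun := fun f => ⟨fun z => z.1 i * f z, shiftCoeff i (coeffEquiv f), hasSum_shiftCoeff i f⟩
      map_add' := fun f g => Subtype.ext <| funext fun z => mul_add _ _ _
      map_smul' := fun a f => Subtype.ext <| funext fun z => mul_left_comm _ _ _ }
    1 (fun f => by
      rw [one_mul, ← norm_coeffEquiv, ← norm_coeffEquiv f, ← norm_shiftCoeff i (coeffEquiv f)]
      exact le_of_eq (congrArg _ (coeff_unique (hasSum_coeff _) (hasSum_shiftCoeff i f))))

theorem mulCoord_apply (i : Fin k) (f : HardySpace k) (z : Polydisc k) :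
    mulCoord i f z = z.1 i * f z := rfl

end HardySpace

/-- The tuple `(M_{z_1}, …, M_{z_k})` on `H²(𝔻^k)`, as a `k`-tuple of `1`-tuples. -/
def coordTuple (k : ℕ) : ∀ _ : Fin k, Fin 1 → HardySpace k →L[ℂ] HardySpace k :=
  fun i _ => HardySpace.mulCoord i

end Polyball

end

open Polyball

/-! The heart is a Wold decomposition. Call a tuple a shift model (`IsShiftModel`) if its space is a
Hilbert sum of copies of one space `L`, indexed by tuples of words, and the operators prepend
letters to the indices. Given an orthonormal basis of `E` that `W` shifts, `W ⊗ I_L` is a shift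
model over `L` (`isShiftModel_amplTuple`), and two shift models over the same `L` are unitarily
equivalent (`IsShiftModel.exists_equiv`).

A shift model is doubly commuting, row isometric and pure. The last two properties pass to every
invariant subspace `M`; purity does so because it is phrased through subspaces `X` with `X ⊆ ∑ j, T
i j X`, without adjoints. Double commutation involves adjoints in `B(M)` and need not pass to `M`,
so it is the property that has to be characterized.

If the restriction to `M` is doubly commuting, `isShiftModel_wordEmbedding` makes it a shift model
over its wandering subspace `L`, the joint kernel of the adjoints. The unitary from `E ⊗ L` onto
`M`, followed by the inclusion, is `Φ`. Conversely, an isometric multi-analytic `Φ` with range `M`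
is a unitary onto `M` that carries the shift model there, and shift models doubly commute. Parts (a)
and (b) differ only in the basis being shifted. -/

noncomputable section

open scoped TensorProduct

namespace Polyball

/-! ### Tuples of words -/

section Words

variable {k : ℕ} {n : Fin k → ℕ}

theorem prepend_apply_self (i : Fin k) (j : Fin (n i)) (β : Words n) :
    prepend i j β i = FreeMonoid.of j * β i := by
  simp [prepend]

theorem prepend_apply_of_ne {i l : Fin k} (h : l ≠ i) (j : Fin (n i)) (β : Words n) :
    prepend i j β l = β l := by
  simp [prepend, h]

/-- In the product monoid, prepending is a left multiplication, so different positions commute and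
monoid homomorphisms such as `wordProd` turn it into a product of operators. -/
theorem prepend_eq_mulSingle_mul (i : Fin k) (j : Fin (n i)) (β : Words n) :
    prepend i j β = Pi.mulSingle i (FreeMonoid.of j) * β := by
  funext l
  by_cases h : l = i
  · subst h; simp [prepend]
  · simp [prepend, h]

theorem prepend_comm {i₁ i₂ : Fin k} (h : i₁ ≠ i₂) (j₁ : Fin (n i₁)) (j₂ : Fin (n i₂))
    (β : Words n) : prepend i₁ j₁ (prepend i₂ j₂ β) = prepend i₂ j₂ (prepend i₁ j₁ β) := by
  simp only [prepend_eq_mulSingle_mul, ← mul_assoc]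
  exact congrArg (· * β) (Pi.mulSingle_commute (f := fun i => FreeMonoid (Fin (n i))) h _ _).eq

theorem of_mul_inj {α : Type*} {a b : α} {u v : FreeMonoid α}
    (h : FreeMonoid.of a * u = FreeMonoid.of b * v) : a = b ∧ u = v := by
  have h' := congrArg FreeMonoid.toList h
  simpa using h'

theorem prepend_ne_of_ne {i : Fin k} {j j' : Fin (n i)} (h : j ≠ j') (β γ : Words n) :
    prepend i j β ≠ prepend i j' γ := fun hβ => by
  have := congrFun hβ i
  rw [prepend_apply_self, prepend_apply_self] at this
  exact h (of_mul_inj this).1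

theorem prepend_ne_of_apply_eq_one {i : Fin k} (j : Fin (n i)) (β : Words n) {γ : Words n}
    (h : γ i = 1) : prepend i j β ≠ γ := fun hβ => by
  have := congrArg FreeMonoid.length (congrFun hβ i)
  rw [prepend_apply_self, h] at this
  simp at this

/-- Either the `i`-th word is empty, or it has a first letter. -/
theorem apply_eq_one_or_eq_prepend (i : Fin k) (β : Words n) :
    β i = 1 ∨ ∃ j γ, β = prepend i j γ := by
  rcases h : FreeMonoid.toList (β i) with _ | ⟨j, w⟩
  · exact Or.inl h
  · refine Or.inr ⟨j, Function.update β i (FreeMonoid.ofList w), ?_⟩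
    have h' : β i = FreeMonoid.of j * FreeMonoid.ofList w := h
    simp [prepend, ← h']

/-- Induction on the total length of the words: a tuple other than `1` has a nonempty word, whose
first letter can be stripped. -/
theorem words_induction {P : Words n → Prop} (one : P 1)
    (step : ∀ i j β, P β → P (prepend i j β)) (β : Words n) : P β := by
  induction hN : ∑ i, (β i).length using Nat.strong_induction_on generalizing β with
  | _ N ih =>
    by_cases h1 : β = 1
    · rwa [h1]
    · obtain ⟨i, hi⟩ : ∃ i, β i ≠ 1 := by
        by_contra! h
        exact h1 (funext h)
      obtain ⟨j, γ, rfl⟩ := (apply_eq_one_or_eq_prepend i β).resolve_left hi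
      refine step i j γ (ih _ ?_ γ rfl)
      rw [← hN]
      refine Finset.sum_lt_sum (fun l _ => ?_) ⟨i, Finset.mem_univ _, ?_⟩
      · by_cases hl : l = i
        · subst hl; simp [prepend_apply_self]
        · rw [prepend_apply_of_ne hl]
      · simp [prepend_apply_self]

end Words

/-! ### Shift models -/

section Model

variable {k : ℕ} {n : Fin k → ℕ}
variable {K : Type*} [NormedAddCommGroup K] [InnerProductSpace ℂ K]
variable {L : Type*} [NormedAddCommGroup L] [InnerProductSpace ℂ L]

/-- `K` is the closed orthogonal sum of copies `ι β L` of `L`, which the operators `T i j` permute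
in the way that `W_{i,j}` permutes the basis vectors of the Fock space. -/
structure IsShiftModel (T : ∀ i, Fin (n i) → K →L[ℂ] K) (ι : Words n → L →ₗᵢ[ℂ] K) : Prop where
  orthogonal : OrthogonalFamily ℂ (fun _ : Words n => L) ι
  dense : (⨆ β, LinearMap.range (ι β).toLinearMap).topologicalClosure = ⊤
  shift : ∀ i j β l, T i j (ι β l) = ι (prepend i j β) l

/-- The joint kernel of the adjoints of the entries of a tuple of operators. -/
def wanderingSubspace [CompleteSpace K] (T : ∀ i, Fin (n i) → K →L[ℂ] K) : Submodule ℂ K where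
  carrier := {x | ∀ i j, ContinuousLinearMap.adjoint (T i j) x = 0}
  zero_mem' := fun i j => map_zero _
  add_mem' := fun hx hy i j => by rw [map_add, hx, hy, add_zero]
  smul_mem' := fun a x hx i j => by rw [map_smul, hx, smul_zero]

/-- Each row `(T_{i,1}, …, T_{i,n_i})` consists of isometries with orthogonal ranges. -/
def IsRowIsometric (T : ∀ i, Fin (n i) → K →L[ℂ] K) : Prop :=
  ∀ i j j' x y, inner ℂ (T i j x) (T i j' y) = if j = j' then inner ℂ x y else 0

/-- No row `(T_{i,1}, …, T_{i,n_i})` maps tuples of vectors of a nonzero subspace `X` onto `X`. -/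
def IsPure (T : ∀ i, Fin (n i) → K →L[ℂ] K) : Prop :=
  ∀ i, ∀ X : Submodule ℂ K, (∀ x ∈ X, ∃ y : Fin (n i) → K, (∀ j, y j ∈ X) ∧ x = ∑ j, T i j (y j)) →
    ∀ x ∈ X, x = 0

theorem IsRowIsometric.adjoint_apply [CompleteSpace K] {T : ∀ i, Fin (n i) → K →L[ℂ] K}
    (hT : IsRowIsometric T) (i : Fin k) (j j' : Fin (n i)) (x : K) :
    ContinuousLinearMap.adjoint (T i j) (T i j' x) = if j = j' then x else 0 := by
  refine ext_inner_left ℂ fun y => ?_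
  rw [ContinuousLinearMap.adjoint_inner_right, hT]
  split_ifs <;> simp

theorem IsRowIsometric.restrict {T : ∀ i, Fin (n i) → K →L[ℂ] K} (hT : IsRowIsometric T)
    {M : Submodule ℂ K} (hM : IsJointlyInvariant T M) : IsRowIsometric (restrictTuple T M hM) :=
  fun i j j' x y => hT i j j' x y

theorem IsPure.restrict {T : ∀ i, Fin (n i) → K →L[ℂ] K} (hT : IsPure T)
    {M : Submodule ℂ K} (hM : IsJointlyInvariant T M) : IsPure (restrictTuple T M hM) := by
  intro i X hX x hx
  refine Subtype.ext (hT i (X.map M.subtype) ?_ x ⟨x, hx, rfl⟩)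
  rintro _ ⟨z, hz, rfl⟩
  obtain ⟨y, hy, hzy⟩ := hX z hz
  refine ⟨fun j => y j, fun j => ⟨y j, hy j, rfl⟩, ?_⟩
  rw [hzy, map_sum]
  rfl

namespace IsShiftModel

variable {T : ∀ i, Fin (n i) → K →L[ℂ] K} {ι : Words n → L →ₗᵢ[ℂ] K}

theorem ext_inner (hT : IsShiftModel T ι) {x y : K}
    (h : ∀ β l, inner ℂ (ι β l) x = inner ℂ (ι β l) y) : x = y := by
  have hle : (⨆ β, LinearMap.range (ι β).toLinearMap).topologicalClosure ≤
      (ℂ ∙ (x - y))ᗮ := by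
    refine Submodule.topologicalClosure_minimal _ (iSup_le fun β => ?_)
      (Submodule.isClosed_orthogonal _)
    rintro _ ⟨l, rfl⟩
    rw [Submodule.mem_orthogonal_singleton_iff_inner_left, inner_sub_right]
    exact sub_eq_zero.2 (h β l)
  rw [hT.dense] at hle
  have := Submodule.mem_orthogonal_singleton_iff_inner_left.1 (hle (Submodule.mem_top (x := x - y)))
  exact sub_eq_zero.1 (inner_self_eq_zero.1 this)

theorem ext_clm (hT : IsShiftModel T ι) {K' : Type*} [NormedAddCommGroup K']
    [InnerProductSpace ℂ K'] {A B : K →L[ℂ] K'} (h : ∀ β l, A (ι β l) = B (ι β l)) : A = B := by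
  have hle : (⨆ β, LinearMap.range (ι β).toLinearMap).topologicalClosure ≤
      LinearMap.ker ((A - B : K →L[ℂ] K') : K →ₗ[ℂ] K') := by
    refine Submodule.topologicalClosure_minimal _ (iSup_le fun β => ?_) (A - B).isClosed_ker
    rintro _ ⟨l, rfl⟩
    simpa using sub_eq_zero.2 (h β l)
  rw [hT.dense] at hle
  ext x
  have := hle (Submodule.mem_top (x := x))
  exact sub_eq_zero.1 (by simpa using this)

theorem inner_self (β : Words n) (l l' : L) : inner ℂ (ι β l) (ι β l') = inner ℂ l l' :=
  (ι β).inner_map_map l l'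

theorem inner_of_ne (hT : IsShiftModel T ι) {β γ : Words n} (h : β ≠ γ) (l l' : L) :
    inner ℂ (ι β l) (ι γ l') = 0 :=
  hT.orthogonal h l l'

variable [CompleteSpace K]

theorem adjoint_prepend (hT : IsShiftModel T ι) (i : Fin k) (j : Fin (n i)) (β : Words n) (l : L) :
    ContinuousLinearMap.adjoint (T i j) (ι (prepend i j β) l) = ι β l := by
  refine hT.ext_inner fun γ l' => ?_
  rw [ContinuousLinearMap.adjoint_inner_right, hT.shift]
  by_cases h : γ = β
  · subst h; rw [inner_self, inner_self]
  · rw [hT.inner_of_ne h, hT.inner_of_ne ((prepend_injective i j).ne h)]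

theorem adjoint_of_forall_ne (hT : IsShiftModel T ι) {i : Fin k} {j : Fin (n i)} {β : Words n}
    (h : ∀ γ, prepend i j γ ≠ β) (l : L) : ContinuousLinearMap.adjoint (T i j) (ι β l) = 0 := by
  refine hT.ext_inner fun γ l' => ?_
  rw [ContinuousLinearMap.adjoint_inner_right, hT.shift, hT.inner_of_ne (h γ), inner_zero_right]

/-- The relations amount to `(T i j)* (T i j') = δ_{jj'} I`, which by density is checked on the
copies of `L`. -/
theorem isRowIsometric (hT : IsShiftModel T ι) : IsRowIsometric T := by
  intro i j j' x y
  have h : ContinuousLinearMap.adjoint (T i j) ∘L T i j' =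
      if j = j' then ContinuousLinearMap.id ℂ K else 0 := by
    refine hT.ext_clm fun β l => ?_
    rw [ContinuousLinearMap.comp_apply, hT.shift]
    split_ifs with hj
    · subst hj; simp [hT.adjoint_prepend]
    · simp [hT.adjoint_of_forall_ne fun γ => prepend_ne_of_ne hj γ β]
  rw [← ContinuousLinearMap.adjoint_inner_right, ← ContinuousLinearMap.comp_apply, h]
  split_ifs <;> simp

/-- Each `x ∈ X` is orthogonal to the copy at `β`, by induction on the length of `β i`. In `x = ∑ j,
T i j (y j)` the adjoints either kill `ι β l` or strip a letter from `β i`, which leaves a pairing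
with some `y j ∈ X`. -/
theorem isPure (hT : IsShiftModel T ι) : IsPure T := by
  intro i X hX
  have key : ∀ N : ℕ, ∀ β : Words n, (β i).length = N → ∀ l, ∀ x ∈ X,
      inner ℂ (ι β l) x = 0 := by
    intro N
    induction N with
    | zero =>
      intro β hβ l x hx
      obtain ⟨y, -, rfl⟩ := hX x hx
      rw [inner_sum]
      refine Finset.sum_eq_zero fun j _ => ?_
      rw [← ContinuousLinearMap.adjoint_inner_left, hT.adjoint_of_forall_ne
        fun γ => prepend_ne_of_apply_eq_one j γ (FreeMonoid.length_eq_zero.1 hβ), inner_zero_left]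
    | succ N ih =>
      intro β hβ l x hx
      obtain ⟨y, hy, rfl⟩ := hX x hx
      rw [inner_sum]
      refine Finset.sum_eq_zero fun j _ => ?_
      rw [← ContinuousLinearMap.adjoint_inner_left]
      by_cases h : ∃ γ, prepend i j γ = β
      · obtain ⟨γ, rfl⟩ := h
        rw [hT.adjoint_prepend]
        refine ih γ ?_ l _ (hy j)
        rw [prepend_apply_self, FreeMonoid.length_mul, FreeMonoid.length_of] at hβ
        omega
      · push Not at h
        rw [hT.adjoint_of_forall_ne h, inner_zero_left]
  intro x hx
  exact hT.ext_inner fun β l => by rw [key _ β rfl l x hx, inner_zero_right]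

theorem doublyCommuting (hT : IsShiftModel T ι) : DoublyCommuting n K T := by
  intro i₁ i₂ hi j₁ j₂
  refine ⟨hT.ext_clm fun β l => ?_, hT.ext_clm fun β l => ?_⟩
  · simp only [ContinuousLinearMap.comp_apply, hT.shift, prepend_comm hi]
  · simp only [ContinuousLinearMap.comp_apply, hT.shift]
    by_cases h : ∃ γ, prepend i₂ j₂ γ = β
    · obtain ⟨γ, rfl⟩ := h
      rw [hT.adjoint_prepend, prepend_comm hi, hT.adjoint_prepend, hT.shift]
    · push Not at h
      -- Changing the word at `i₁` leaves the one at `i₂` alone, so neither `β` nor `prepend i₁ j₁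
      -- β` begins with `j₂` there, and both sides vanish.
      rw [hT.adjoint_of_forall_ne h, map_zero, hT.adjoint_of_forall_ne]
      intro γ hγ
      have hβ : β i₂ = FreeMonoid.of j₂ * γ i₂ := by
        rw [← prepend_apply_self i₂ j₂ γ, hγ, prepend_apply_of_ne hi.symm]
      refine h (Function.update β i₂ (γ i₂)) ?_
      simp [prepend, ← hβ]

/-- Two shift models over the same space are unitarily equivalent. -/
theorem exists_equiv [CompleteSpace L] (hT : IsShiftModel T ι)
    {K' : Type*} [NormedAddCommGroup K'] [InnerProductSpace ℂ K'] [CompleteSpace K']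
    {T' : ∀ i, Fin (n i) → K' →L[ℂ] K'} {ι' : Words n → L →ₗᵢ[ℂ] K'} (hT' : IsShiftModel T' ι') :
    ∃ U : K ≃ₗᵢ[ℂ] K', ∀ i j x, U (T i j x) = T' i j (U x) := by
  -- Both spaces are identified with the same `ℓ²`-sum of copies of `L`; `U` matches the copies with
  -- equal index.
  have h := IsHilbertSum.mk hT.orthogonal hT.dense.ge
  have h' := IsHilbertSum.mk hT'.orthogonal hT'.dense.ge
  let U : K ≃ₗᵢ[ℂ] K' := h.linearIsometryEquiv.trans h'.linearIsometryEquiv.symm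
  have hU : ∀ β l, U (ι β l) = ι' β l := fun β l => by
    rw [← h.linearIsometryEquiv_symm_apply_single, ← h'.linearIsometryEquiv_symm_apply_single]
    simp only [U, LinearIsometryEquiv.trans_apply, LinearIsometryEquiv.apply_symm_apply]
  refine ⟨U, fun i j x => ?_⟩
  have key : (U.toLinearIsometry.toContinuousLinearMap) ∘L T i j =
      T' i j ∘L U.toLinearIsometry.toContinuousLinearMap :=
    hT.ext_clm fun β l => by simp [hT.shift, hT'.shift, hU]
  exact congrArg (fun A => A x) key

end IsShiftModel

end Model

theorem IsShiftModel.map {k : ℕ} {n : Fin k → ℕ}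
    {K : Type*} [NormedAddCommGroup K] [InnerProductSpace ℂ K]
    {K' : Type*} [NormedAddCommGroup K'] [InnerProductSpace ℂ K']
    {L : Type*} [NormedAddCommGroup L] [InnerProductSpace ℂ L]
    {T : ∀ i, Fin (n i) → K →L[ℂ] K} {T' : ∀ i, Fin (n i) → K' →L[ℂ] K'}
    {ι : Words n → L →ₗᵢ[ℂ] K} (hT : IsShiftModel T ι) (U : K ≃ₗᵢ[ℂ] K')
    (hU : ∀ i j x, U (T i j x) = T' i j (U x)) :
    IsShiftModel T' (fun β => U.toLinearIsometry.comp (ι β)) where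
  orthogonal β γ h l l' := (U.inner_map_map _ _).trans (hT.orthogonal h l l')
  shift i j β l := by
    change T' i j (U (ι β l)) = U (ι (prepend i j β) l)
    rw [← hU, hT.shift]
  dense := by
    set N := (⨆ β, LinearMap.range
      (U.toLinearIsometry.comp (ι β)).toLinearMap).topologicalClosure
    have hle : (⨆ β, LinearMap.range (ι β).toLinearMap).topologicalClosure ≤
        N.comap (U.toLinearEquiv : K →ₗ[ℂ] K') := by
      refine Submodule.topologicalClosure_minimal _ (iSup_le fun β => ?_)
        ((Submodule.isClosed_topologicalClosure _).preimage U.continuous)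
      rintro _ ⟨l, rfl⟩
      exact Submodule.le_topologicalClosure _ (Submodule.mem_iSup_of_mem β ⟨l, rfl⟩)
    rw [hT.dense] at hle
    rw [Submodule.eq_top_iff']
    intro y
    have : U (U.symm y) ∈ N := hle (Submodule.mem_top (x := U.symm y))
    rwa [U.apply_symm_apply] at this

/-! ### The Wold decomposition of a pure doubly commuting tuple of row isometries -/

section Wold

universe v

open ContinuousLinearMap

variable {k : ℕ} {n : Fin k → ℕ}
variable {K : Type*} [NormedAddCommGroup K] [InnerProductSpace ℂ K]

/-- This is the compatibility needed to assemble the rows' word maps into one homomorphism on the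
product of the free monoids. -/
theorem commute_lift_of_doublyCommuting [CompleteSpace K] {V : ∀ i, Fin (n i) → K →L[ℂ] K}
    (hV : DoublyCommuting n K V) : Pairwise fun i₁ i₂ =>
      ∀ x y, Commute (FreeMonoid.lift (V i₁) x) (FreeMonoid.lift (V i₂) y) := by
  intro i₁ i₂ hi x y
  induction x using FreeMonoid.inductionOn' with
  | one => rw [map_one]; exact Commute.one_left _
  | of_mul j x ih =>
    rw [map_mul, FreeMonoid.lift_eval_of]
    refine Commute.mul_left ?_ ih
    clear ih
    induction y using FreeMonoid.inductionOn' with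
    | one => rw [map_one]; exact Commute.one_right _
    | of_mul j' y ih' =>
      rw [map_mul, FreeMonoid.lift_eval_of]
      exact Commute.mul_right (hV i₁ i₂ hi j j').1 ih'

/-- The product `V_β = V_{1,β_1} ⋯ V_{k,β_k}` of the entries of a doubly commuting tuple. -/
def wordProd [CompleteSpace K] {V : ∀ i, Fin (n i) → K →L[ℂ] K} (hV : DoublyCommuting n K V) :
    Words n →* (K →L[ℂ] K) :=
  MonoidHom.noncommPiCoprod (fun i => FreeMonoid.lift (V i)) (commute_lift_of_doublyCommuting hV)

variable [CompleteSpace K] {V : ∀ i, Fin (n i) → K →L[ℂ] K}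

theorem wordProd_prepend (hV : DoublyCommuting n K V) (i : Fin k) (j : Fin (n i)) (β : Words n)
    (x : K) : wordProd hV (prepend i j β) x = V i j (wordProd hV β x) := by
  rw [prepend_eq_mulSingle_mul, map_mul, mul_apply_eq_comp, wordProd,
    MonoidHom.noncommPiCoprod_mulSingle, FreeMonoid.lift_eval_of]

theorem DoublyCommuting.adjoint_apply_comm (hV : DoublyCommuting n K V) {i₁ i₂ : Fin k}
    (h : i₁ ≠ i₂) (j₁ : Fin (n i₁)) (j₂ : Fin (n i₂)) (x : K) :
    adjoint (V i₂ j₂) (V i₁ j₁ x) = V i₁ j₁ (adjoint (V i₂ j₂) x) :=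
  (congrArg (fun A => A x) (hV i₁ i₂ h j₁ j₂).2).symm

theorem DoublyCommuting.adjoint_adjoint_comm (hV : DoublyCommuting n K V) {i₁ i₂ : Fin k}
    (h : i₁ ≠ i₂) (j₁ : Fin (n i₁)) (j₂ : Fin (n i₂)) (x : K) :
    adjoint (V i₂ j₂) (adjoint (V i₁ j₁) x) = adjoint (V i₁ j₁) (adjoint (V i₂ j₂) x) := by
  have := congrArg adjoint (hV i₁ i₂ h j₁ j₂).1
  rw [adjoint_comp, adjoint_comp] at this
  exact congrArg (fun A => A x) this

theorem norm_wordProd (hV : DoublyCommuting n K V) (hr : IsRowIsometric V) (β : Words n) (x : K) :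
    ‖wordProd hV β x‖ = ‖x‖ := by
  induction β using words_induction with
  | one => simp
  | step i j β ih =>
    rw [wordProd_prepend, ← ih, @norm_eq_sqrt_re_inner ℂ, @norm_eq_sqrt_re_inner ℂ _ _ _ _
      (wordProd hV β x), hr, if_pos rfl]

/-- With no letter at position `i`, the adjoint moves past every factor by double commutation and
reaches the wandering vector, which it kills. -/
theorem adjoint_wordProd_of_apply_eq_one (hV : DoublyCommuting n K V) {i : Fin k} (j : Fin (n i))
    {β : Words n} (hβ : β i = 1) {l : K} (hl : l ∈ wanderingSubspace V) :
    adjoint (V i j) (wordProd hV β l) = 0 := by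
  induction β using words_induction with
  | one => simpa using hl i j
  | step i' j' β ih =>
    have hi : i' ≠ i := by
      rintro rfl
      exact prepend_ne_of_apply_eq_one j' β hβ rfl
    rw [prepend_apply_of_ne hi.symm] at hβ
    rw [wordProd_prepend, hV.adjoint_apply_comm hi, ih hβ, map_zero]

/-- Letters are stripped from `β` by moving them across as adjoints: a matching first letter of `γ`
cancels, while a different or missing one gives zero. When `β` is exhausted, a remaining letter of
`γ` annihilates `l`. -/
theorem inner_wordProd_of_ne (hV : DoublyCommuting n K V) (hr : IsRowIsometric V) {β γ : Words n}
    (h : β ≠ γ) {l l' : K} (hl : l ∈ wanderingSubspace V) (hl' : l' ∈ wanderingSubspace V) :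
    inner ℂ (wordProd hV β l) (wordProd hV γ l') = 0 := by
  induction β using words_induction generalizing γ with
  | one =>
    obtain ⟨i, hi⟩ : ∃ i, γ i ≠ 1 := by
      by_contra! h'
      exact h (funext h').symm
    obtain ⟨j, γ, rfl⟩ := (apply_eq_one_or_eq_prepend i γ).resolve_left hi
    rw [wordProd_prepend, ← adjoint_inner_left, map_one, one_apply_eq_self,
      hl i j, inner_zero_left]
  | step i j β ih =>
    rw [wordProd_prepend, ← adjoint_inner_right]
    rcases apply_eq_one_or_eq_prepend i γ with hγ | ⟨j', γ, rfl⟩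
    · rw [adjoint_wordProd_of_apply_eq_one hV j hγ hl', inner_zero_right]
    · rw [wordProd_prepend, hr.adjoint_apply]
      split_ifs with hj
      · subst hj
        exact ih fun hβ => h (by rw [hβ])
      · exact inner_zero_right _

/-- A nonzero subspace that reduces a pure doubly commuting tuple of row isometries contains
nonzero wandering vectors. -/
theorem exists_adjoint_eq_zero_of_reducing (hV : DoublyCommuting n K V) (hr : IsRowIsometric V)
    (hp : IsPure V) (S : Finset (Fin k)) (X : Submodule ℂ K)
    (hX : ∀ i ∈ S, ∀ j, ∀ x ∈ X, V i j x ∈ X ∧ adjoint (V i j) x ∈ X) (hne : ∃ x ∈ X, x ≠ 0) :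
    ∃ x ∈ X, x ≠ 0 ∧ ∀ i ∈ S, ∀ j, adjoint (V i j) x = 0 := by
  induction S using Finset.induction_on generalizing X with
  | empty =>
    obtain ⟨x, hx, h0⟩ := hne
    exact ⟨x, hx, h0, by simp⟩
  | insert i S hi ih =>
    -- `Y` is the part of `X` killed by the adjoints of row `i`. Double commutation makes it
    -- reducing for the rows in `S`, so the induction hypothesis applies once `Y ≠ 0`.
    let Y : Submodule ℂ K :=
      { carrier := {x | x ∈ X ∧ ∀ j, adjoint (V i j) x = 0}
        zero_mem' := ⟨X.zero_mem, fun j => map_zero _⟩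
        add_mem' := fun hx hy => ⟨X.add_mem hx.1 hy.1, fun j => by
          rw [map_add, hx.2, hy.2, add_zero]⟩
        smul_mem' := fun a x hx => ⟨X.smul_mem a hx.1, fun j => by
          rw [map_smul, hx.2, smul_zero]⟩ }
    obtain ⟨x, hxY, hx0, hx⟩ := ih Y (fun i' hi' j' x hx => by
      have hne : i' ≠ i := fun h => hi (h ▸ hi')
      have hX' := hX i' (Finset.mem_insert_of_mem hi') j' x hx.1
      refine ⟨⟨hX'.1, fun j => ?_⟩, ⟨hX'.2, fun j => ?_⟩⟩
      · rw [hV.adjoint_apply_comm hne, hx.2, map_zero]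
      · rw [hV.adjoint_adjoint_comm hne, hx.2, map_zero]) (by
      by_contra! hY
      obtain ⟨x₀, hx₀, h0⟩ := hne
      have hXi := hX i (Finset.mem_insert_self i S)
      -- For `x ∈ X`, the defect `x - ∑ j, V i j ((V i j)* x)` lies in `Y`. If `Y = 0`, row `i`
      -- therefore reproduces `X` from itself, and purity forces `X = 0`.
      refine h0 (hp i X (fun x hx => ⟨fun j => adjoint (V i j) x, fun j => (hXi j x hx).2, ?_⟩)
        x₀ hx₀)
      refine sub_eq_zero.1 (hY _ ⟨X.sub_mem hx (X.sum_mem fun j _ =>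
        (hXi j _ (hXi j x hx).2).1), fun j => ?_⟩)
      rw [map_sub, map_sum]
      simp [hr.adjoint_apply])
    exact ⟨x, hxY.1, hx0, fun i' hi' => by
      rcases Finset.mem_insert.1 hi' with rfl | h
      · exact hxY.2
      · exact hx i' h⟩

/-- The embedding `l ↦ V_β l` of the wandering subspace. -/
def wordEmbedding (hV : DoublyCommuting n K V) (hr : IsRowIsometric V) (β : Words n) :
    wanderingSubspace V →ₗᵢ[ℂ] K where
  toLinearMap := (wordProd hV β : K →ₗ[ℂ] K) ∘ₗ (wanderingSubspace V).subtype
  norm_map' x := norm_wordProd hV hr β x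

/-- A pure doubly commuting tuple of row isometries is a shift model over its wandering
subspace. -/
theorem isShiftModel_wordEmbedding (hV : DoublyCommuting n K V) (hr : IsRowIsometric V)
    (hp : IsPure V) : IsShiftModel V (wordEmbedding hV hr) where
  orthogonal β γ h l l' := inner_wordProd_of_ne hV hr h l.2 l'.2
  shift i j β l := (wordProd_prepend hV i j β l).symm
  dense := by
    set N : Submodule ℂ K := ⨆ β, LinearMap.range (wordEmbedding hV hr β).toLinearMap
    have hmem : ∀ β, ∀ l ∈ wanderingSubspace V, wordProd hV β l ∈ N := fun β l hl =>
      Submodule.mem_iSup_of_mem β ⟨⟨l, hl⟩, rfl⟩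
    have hinv : ∀ A : K →L[ℂ] K, (∀ β, ∀ l ∈ wanderingSubspace V, A (wordProd hV β l) ∈ N) →
        ∀ x ∈ N, A x ∈ N := fun A hA => by
      refine (iSup_le fun β => ?_ : N ≤ N.comap (A : K →ₗ[ℂ] K))
      rintro _ ⟨l, rfl⟩
      exact hA β l l.2
    have h₁ : ∀ i j, ∀ x ∈ N, V i j x ∈ N := fun i j => hinv _ fun β l hl => by
      rw [← wordProd_prepend]
      exact hmem _ l hl
    have h₂ : ∀ i j, ∀ x ∈ N, adjoint (V i j) x ∈ N := fun i j => hinv _ fun β l hl => by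
      rcases apply_eq_one_or_eq_prepend i β with hβ | ⟨j', γ, rfl⟩
      · rw [adjoint_wordProd_of_apply_eq_one hV j hβ hl]
        exact N.zero_mem
      · rw [wordProd_prepend, hr.adjoint_apply]
        split_ifs
        · exact hmem γ l hl
        · exact N.zero_mem
    rw [Submodule.topologicalClosure_eq_top_iff]
    by_contra hbot
    -- `N` is reducing, hence so is `Nᗮ`. If `Nᗮ` were nonzero, it would contain a nonzero wandering
    -- vector, but such vectors lie in `N` as the copy at `β = 1`.
    obtain ⟨x, hx, hx0, hxw⟩ := exists_adjoint_eq_zero_of_reducing hV hr hp Finset.univ Nᗮ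
      (fun i _ j x hx => by
        simp only [Submodule.mem_orthogonal] at hx ⊢
        refine ⟨fun u hu => ?_, fun u hu => ?_⟩
        · rw [← adjoint_inner_left]
          exact hx _ (h₂ i j u hu)
        · rw [adjoint_inner_right]
          exact hx _ (h₁ i j u hu))
      ((Submodule.ne_bot_iff _).1 hbot)
    have hxN : x ∈ N := by
      simpa using hmem 1 x fun i j => hxw i (Finset.mem_univ i) j
    exact hx0 (inner_self_eq_zero.1 (hx x hxN))

theorem isClosed_wanderingSubspace (V : ∀ i, Fin (n i) → K →L[ℂ] K) :
    IsClosed (wanderingSubspace V : Set K) := by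
  have : (wanderingSubspace V : Set K) = ⋂ i, ⋂ j, {x | adjoint (V i j) x = 0} := by
    ext x
    simp [wanderingSubspace]
  rw [this]
  exact isClosed_iInter fun i => isClosed_iInter fun j =>
    isClosed_eq (adjoint (V i j)).continuous continuous_const

theorem exists_isShiftModel {K : Type v} [NormedAddCommGroup K] [InnerProductSpace ℂ K]
    [CompleteSpace K] {V : ∀ i, Fin (n i) → K →L[ℂ] K} (hV : DoublyCommuting n K V)
    (hr : IsRowIsometric V) (hp : IsPure V) :
    ∃ (L : Type v) (_ : NormedAddCommGroup L) (_ : InnerProductSpace ℂ L) (_ : CompleteSpace L)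
      (ι : Words n → L →ₗᵢ[ℂ] K), IsShiftModel V ι :=
  ⟨wanderingSubspace V, inferInstance, inferInstance,
    (isClosed_wanderingSubspace V).completeSpace_coe, wordEmbedding hV hr,
    isShiftModel_wordEmbedding hV hr hp⟩

end Wold

/-! ### Ampliations of shifts -/

section Ampliation

variable {k : ℕ} {n : Fin k → ℕ}
variable {E : Type*} [NormedAddCommGroup E] [InnerProductSpace ℂ E]
variable {L : Type*} [NormedAddCommGroup L] [InnerProductSpace ℂ L]

/-- The embedding `l ↦ e ⊗ l` for a unit vector `e`. -/
def tmulIsometry (L : Type*) [NormedAddCommGroup L] [InnerProductSpace ℂ L] (e : E)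
    (he : ‖e‖ = 1) : L →ₗᵢ[ℂ] HTensor E L where
  toFun l := ((e ⊗ₜ[ℂ] l : E ⊗[ℂ] L) : HTensor E L)
  map_add' l l' := by rw [TensorProduct.tmul_add, UniformSpace.Completion.coe_add]
  map_smul' a l := by rw [TensorProduct.tmul_smul, UniformSpace.Completion.coe_smul]; rfl
  norm_map' l := by
    change ‖((e ⊗ₜ[ℂ] l : E ⊗[ℂ] L) : HTensor E L)‖ = ‖l‖
    rw [UniformSpace.Completion.norm_coe, TensorProduct.norm_tmul, he, one_mul]

theorem tmulIsometry_apply (e : E) (he : ‖e‖ = 1) (l : L) :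
    tmulIsometry L e he l = ((e ⊗ₜ[ℂ] l : E ⊗[ℂ] L) : HTensor E L) := rfl

/-- If `W` shifts an orthonormal basis of `E`, then `W ⊗ I_L` is a shift model over `L`. -/
theorem isShiftModel_amplTuple {W : ∀ i, Fin (n i) → E →L[ℂ] E} {b : Words n → E}
    (hb : Orthonormal ℂ b) (hd : (Submodule.span ℂ (Set.range b)).topologicalClosure = ⊤)
    (hW : ∀ i j β, W i j (b β) = b (prepend i j β)) :
    IsShiftModel (amplTuple W L) (fun β => tmulIsometry L (b β) (hb.1 β)) where
  orthogonal β γ h l l' := by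
    rw [tmulIsometry_apply, tmulIsometry_apply, UniformSpace.Completion.inner_coe,
      TensorProduct.inner_tmul, hb.2 h, zero_mul]
  shift i j β l := by
    rw [amplTuple, tmulIsometry_apply, ampl_tmul, hW, tmulIsometry_apply]
  dense := by
    set N : Submodule ℂ (HTensor E L) :=
      (⨆ β, LinearMap.range (tmulIsometry L (b β) (hb.1 β)).toLinearMap).topologicalClosure
    have hN : IsClosed (N : Set (HTensor E L)) := Submodule.isClosed_topologicalClosure _
    have htmul : ∀ (e : E) (l : L), ((e ⊗ₜ[ℂ] l : E ⊗[ℂ] L) : HTensor E L) ∈ N := by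
      intro e l
      -- Continuity of `e ↦ e ⊗ l` carries density of the span of `b` over to all simple tensors.
      let A : E →L[ℂ] HTensor E L :=
        UniformSpace.Completion.toComplL ∘L (TensorProduct.mkL ℂ E L).flip l
      have hle : (Submodule.span ℂ (Set.range b)).topologicalClosure ≤
          N.comap (A : E →ₗ[ℂ] HTensor E L) := by
        refine Submodule.topologicalClosure_minimal _ ?_ (hN.preimage A.continuous)
        rw [Submodule.span_le]
        rintro _ ⟨β, rfl⟩
        exact Submodule.le_topologicalClosure _ (Submodule.mem_iSup_of_mem β ⟨l, rfl⟩)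
      rw [hd] at hle
      exact hle (Submodule.mem_top (x := e))
    rw [Submodule.eq_top_iff']
    intro x
    induction x using UniformSpace.Completion.induction_on with
    | hp => exact hN
    | ih t =>
      induction t using TensorProduct.induction_on with
      | zero => exact N.zero_mem
      | tmul e l => exact htmul e l
      | add s t hs ht =>
        rw [UniformSpace.Completion.coe_add]
        exact N.add_mem hs ht

end Ampliation

/-! ### The Beurling theorem for an abstract shifted basis -/

section Beurling

universe v

variable {k : ℕ} {n : Fin k → ℕ}
variable {E : Type} [NormedAddCommGroup E] [InnerProductSpace ℂ E]
variable {H : Type v} [NormedAddCommGroup H] [InnerProductSpace ℂ H]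

/-- The Beurling theorem for a tuple `W` that shifts an orthonormal basis of `E`. -/
theorem doublyCommuting_restrict_iff {W : ∀ i, Fin (n i) → E →L[ℂ] E} {b : Words n → E}
    (hb : Orthonormal ℂ b) (hd : (Submodule.span ℂ (Set.range b)).topologicalClosure = ⊤)
    (hW : ∀ i j β, W i j (b β) = b (prepend i j β))
    (M : ClosedSubmodule ℂ (HTensor E H))
    (hM : IsJointlyInvariant (amplTuple W H) M.toSubmodule) :
    DoublyCommuting n M.toSubmodule (restrictTuple (amplTuple W H) M.toSubmodule hM) ↔
      ∃ (L : Type v) (_ : NormedAddCommGroup L) (_ : InnerProductSpace ℂ L)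
        (_ : CompleteSpace L) (Φ : HTensor E L →L[ℂ] HTensor E H),
        Isometry Φ ∧ IsMultiAnalytic W Φ ∧ (M : Set _) = Set.range Φ := by
  constructor
  · intro hV
    have hH := isShiftModel_amplTuple (L := H) hb hd hW
    obtain ⟨L, _, _, _, ι, hVM⟩ := exists_isShiftModel hV (hH.isRowIsometric.restrict hM)
      (hH.isPure.restrict hM)
    obtain ⟨U, hU⟩ := (isShiftModel_amplTuple (L := L) hb hd hW).exists_equiv hVM
    refine ⟨L, inferInstance, inferInstance, inferInstance,
      M.toSubmodule.subtypeL ∘L U.toLinearIsometry.toContinuousLinearMap, ?_, ?_, ?_⟩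
    · exact isometry_subtype_coe.comp U.isometry
    · exact fun i j => ContinuousLinearMap.ext fun x => congrArg Subtype.val (hU i j x)
    · ext x
      constructor
      · intro hx
        obtain ⟨y, hy⟩ := U.surjective ⟨x, hx⟩
        exact ⟨y, congrArg Subtype.val hy⟩
      · rintro ⟨y, rfl⟩
        exact (U y).2
  · rintro ⟨L, _, _, _, Φ, hΦ, hA, hR⟩
    have hL := isShiftModel_amplTuple (L := L) hb hd hW
    have hmem : ∀ x, Φ x ∈ M.toSubmodule := fun x => by
      have : Φ x ∈ (M : Set (HTensor E H)) := hR ▸ ⟨x, rfl⟩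
      exact this
    -- With codomain `M`, `Φ` is unitary, so the transported shift model lives on `M` and its
    -- adjoints are those of `B(M)`.
    let Ψ : HTensor E L ≃ₗᵢ[ℂ] M.toSubmodule := LinearIsometryEquiv.ofSurjective
      { toLinearMap := (Φ : HTensor E L →ₗ[ℂ] HTensor E H).codRestrict M.toSubmodule hmem
        norm_map' := fun x => (AddMonoidHomClass.isometry_iff_norm Φ).1 hΦ x }
      (fun y => by
        have hy : (y : HTensor E H) ∈ Set.range Φ := hR ▸ y.2
        obtain ⟨x, hx⟩ := hy
        exact ⟨x, Subtype.ext hx⟩)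
    have hΨ : ∀ i j x, Ψ (amplTuple W L i j x) =
        restrictTuple (amplTuple W H) M.toSubmodule hM i j (Ψ x) := fun i j x =>
      Subtype.ext (congrArg (fun A : HTensor E L →L[ℂ] HTensor E H => A x) (hA i j))
    exact (hL.map Ψ hΨ).doublyCommuting

end Beurling

/-! ### The two universal models -/

/-- This serves both models: `e` is the identity for the Fock space and the Taylor coefficient map
for the Hardy space. -/
theorem isometryEquiv_symm_single_orthonormal {ι E : Type*} [DecidableEq ι]
    [NormedAddCommGroup E] [InnerProductSpace ℂ E] (e : E ≃ₗᵢ[ℂ] lp (fun _ : ι => ℂ) 2) :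
    Orthonormal ℂ (fun i => e.symm (lp.single 2 i 1)) ∧
      (Submodule.span ℂ (Set.range fun i => e.symm (lp.single 2 i (1 : ℂ)))).topologicalClosure =
        ⊤ := by
  have h : (fun i => e.symm (lp.single 2 i (1 : ℂ))) = HilbertBasis.ofRepr e :=
    funext fun i => (HilbertBasis.ofRepr e).repr_symm_single i
  rw [h]
  exact ⟨HilbertBasis.orthonormal _, HilbertBasis.dense_span _⟩

theorem orthonormal_basisVec {k : ℕ} {n : Fin k → ℕ} :
    Orthonormal ℂ (basisVec : Words n → PolyFock n) :=
  (isometryEquiv_symm_single_orthonormal (LinearIsometryEquiv.refl ℂ (PolyFock n))).1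

theorem dense_span_basisVec {k : ℕ} {n : Fin k → ℕ} :
    (Submodule.span ℂ (Set.range (basisVec : Words n → PolyFock n))).topologicalClosure = ⊤ :=
  (isometryEquiv_symm_single_orthonormal (LinearIsometryEquiv.refl ℂ (PolyFock n))).2

namespace HardySpace

variable {k : ℕ}

/-- The unitary operator of `H²(𝔻^k)` onto `ℓ²(ℕ^k)`. -/
def coeffIsometryEquiv : HardySpace k ≃ₗᵢ[ℂ] lp (fun _ : Fin k → ℕ => ℂ) 2 :=
  ⟨coeffEquiv, norm_coeffEquiv⟩

theorem coeffEquiv_mulCoord (i : Fin k) (f : HardySpace k) :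
    coeffEquiv (mulCoord i f) = shiftCoeff i (coeffEquiv f) :=
  coeff_unique (hasSum_coeff _) (hasSum_shiftCoeff i f)

theorem shiftCoeff_single (i : Fin k) (α : Fin k → ℕ) :
    shiftCoeff i (lp.single 2 α 1) = lp.single 2 (raise i α) 1 := by
  ext γ
  by_cases h : γ ∈ Set.range (raise i)
  · obtain ⟨δ, rfl⟩ := h
    rw [shiftCoeff_raise]
    simp [lp.single_apply, Pi.single_apply, (raise_injective i).eq_iff]
  · rw [shiftCoeff_of_notMem i _ h]
    have hne : γ ≠ raise i α := fun hγ => h ⟨α, hγ.symm⟩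
    simp [lp.single_apply, hne]

/-- The monomial `z^α` as an element of `H²(𝔻^k)`. -/
def monomialVec (α : Fin k → ℕ) : HardySpace k := coeffIsometryEquiv.symm (lp.single 2 α 1)

theorem mulCoord_monomialVec (i : Fin k) (α : Fin k → ℕ) :
    mulCoord i (monomialVec α) = monomialVec (raise i α) := by
  refine coeffEquiv.injective ?_
  have h : ∀ α : Fin k → ℕ, coeffEquiv (monomialVec α) = lp.single 2 α 1 := fun α =>
    coeffIsometryEquiv.apply_symm_apply _
  rw [coeffEquiv_mulCoord, h, h, shiftCoeff_single]

end HardySpace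

/-- The exponents `α_i = |β_i|` for a tuple of words in one letter each. -/
def wordExponent {k : ℕ} (β : Words (fun _ : Fin k => 1)) : Fin k → ℕ := fun i => (β i).length

theorem wordExponent_prepend {k : ℕ} (i : Fin k) (j : Fin 1) (β : Words (fun _ : Fin k => 1)) :
    wordExponent (prepend i j β) = HardySpace.raise i (wordExponent β) := by
  funext l
  by_cases h : l = i
  · subst h
    simp [wordExponent, HardySpace.raise, prepend_apply_self, add_comm]
  · simp [wordExponent, HardySpace.raise, prepend_apply_of_ne h, h]

/-- A word in one letter is determined by its length, so the monomials can be indexed by tuples of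
words. -/
theorem wordExponent_bijective {k : ℕ} : Function.Bijective (wordExponent (k := k)) := by
  constructor
  · intro β γ h
    funext i
    refine FreeMonoid.toList.injective (List.ext_getElem (congrFun h i) fun _ _ _ => ?_)
    exact Subsingleton.elim _ _
  · intro α
    exact ⟨fun i => FreeMonoid.ofList (List.replicate (α i) 0), funext fun i => by
      simp [wordExponent, FreeMonoid.length]⟩

end Polyball

end

theorem mainTheorem7 {k : ℕ} (hk : 1 ≤ k)
    (H : Type u) [NormedAddCommGroup H] [InnerProductSpace ℂ H] [CompleteSpace H] :
    (∀ n : Fin k → ℕ, (∀ i, 1 ≤ n i) →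
      ∀ (M : ClosedSubmodule ℂ (HTensor (PolyFock n) H))
        (hM : IsJointlyInvariant (amplTuple (universalModel n) H) M.toSubmodule), M ≠ ⊥ →
        (DoublyCommuting n M.toSubmodule
            (restrictTuple (amplTuple (universalModel n) H) M.toSubmodule hM) ↔
          ∃ (L : Type u) (_ : NormedAddCommGroup L) (_ : InnerProductSpace ℂ L)
            (_ : CompleteSpace L) (Φ : HTensor (PolyFock n) L →L[ℂ] HTensor (PolyFock n) H),
            Isometry Φ ∧ IsMultiAnalytic (universalModel n) Φ ∧ (M : Set _) = Set.range Φ)) ∧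
    (∀ (M : ClosedSubmodule ℂ (HTensor (HardySpace k) H))
        (hM : IsJointlyInvariant (n := fun _ => 1) (amplTuple (coordTuple k) H) M.toSubmodule), M ≠ ⊥ →
        (DoublyCommuting (fun _ => 1) M.toSubmodule
            (restrictTuple (amplTuple (coordTuple k) H) M.toSubmodule hM) ↔
          ∃ (L : Type u) (_ : NormedAddCommGroup L) (_ : InnerProductSpace ℂ L)
            (_ : CompleteSpace L) (Φ : HTensor (HardySpace k) L →L[ℂ] HTensor (HardySpace k) H),
            Isometry Φ ∧ IsMultiAnalytic (n := fun _ => 1) (coordTuple k) Φ ∧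
              (M : Set _) = Set.range Φ)) := by
  refine ⟨fun n _ M hM _ => ?_, fun M hM _ => ?_⟩
  · exact doublyCommuting_restrict_iff orthonormal_basisVec dense_span_basisVec
      (universalModel_basisVec n) M hM
  · have h := isometryEquiv_symm_single_orthonormal (HardySpace.coeffIsometryEquiv (k := k))
    -- The shifted basis is that of the monomials: `z_i z^α = z^(α + ε_i)` corresponds to prepending
    -- the only letter at position `i`.
    refine doublyCommuting_restrict_iff (n := fun _ => 1)
      (b := fun β => HardySpace.monomialVec (wordExponent β)) ?_ ?_ ?_ M hM
    · exact h.1.comp _ wordExponent_bijective.injective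
    · have hr : Set.range (fun β => HardySpace.monomialVec (wordExponent (k := k) β)) =
          Set.range HardySpace.monomialVec :=
        wordExponent_bijective.surjective.range_comp HardySpace.monomialVec
      rw [hr]
      exact h.2
    · intro i j β
      rw [wordExponent_prepend]
      exact HardySpace.mulCoord_monomialVec i _
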